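/- Let $n\ge 1$ be an integer, let $t,s>0$ and let $1\le p<\infty$. For $z,w\in\mathbb{C}^n$ write $\langle z,w\rangle=\sum_{k=1}^n z_k\overline{w_k}$ and $|z|^2=\sum_{k=1}^n|z_k|^2$, and for $r>0$ let $$dv_r(z)=\left(\frac r\pi\right)^n e^{-r|z|^2}\,dv(z),$$ where $dv$ is Lebesgue measure on $\mathbb{C}^n$. Consider the integral operators $$S_tf(z)=\int_{\mathbb{C}^n}e^{t\langle z,w\rangle}f(w)\,dv_t(w),\qquad T_tf(z)=\int_{\mathbb{C}^n}\left|e^{t\langle z,w\rangle}\right|f(w)\,dv_t(w).$$ Such an operator is called bounded on the complex space $L^p(\mathbb{C}^n,dv_s)$ if, for every $f\in L^p(\mathbb{C}^n,dv_s)$, the defining integral converges absolutely for almost every $z$, and the resulting map is a bounded linear operator of $L^p(\mathbb{C}^n,dv_s)$ into itself. Then the following conditions are equivalent: (a) $T_t$ is bounded on $L^p(\mathbb{C}^n,dv_s)$; (b) $S_t$ is bounded on $L^p(\mathbb{C}^n,dv_s)$; (c) $pt=2s$. They are also equivalent to each of the conditions (a$'$) and (b$'$) that $T_t$, respectively $S_t$,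 restricted to those $f\in L^p(\mathbb{C}^n,dv_s)$ for which the defining integral converges absolutely for almost every $z$, extends to a bounded linear operator on $L^p(\mathbb{C}^n,dv_s)$. Furthermore, whenever $pt=2s$, the operator norms of $S_t$ and $T_t$ on $L^p(\mathbb{C}^n,dv_s)$ satisfy $$\|S_t\|\le\|T_t\|=2^n.$$ -/

import Mathlib

open MeasureTheory
open scoped ENNReal

noncomputable section

/-- The Hermitian pairing `⟨z, w⟩ = z₁ w̄₁ + ⋯ + zₙ w̄ₙ` on `ℂⁿ`, linear in the first variable. -/
def fockInner {n : ℕ} (z w : Fin n → ℂ) : ℂ :=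
  ∑ i, z i * (starRingEnd ℂ) (w i)

/-- The squared Euclidean norm `|z|² = |z₁|² + ⋯ + |zₙ|²` on `ℂⁿ`. -/
def fockNormSq {n : ℕ} (z : Fin n → ℂ) : ℝ :=
  ∑ i, ‖z i‖ ^ 2

/-- The Gaussian measure `dv_t(z) = (t/π)ⁿ e^{-t|z|²} dv(z)` on `ℂⁿ`, where `dv` is Lebesgue
measure. -/
def gaussianVol (n : ℕ) (t : ℝ) : Measure (Fin n → ℂ) :=
  (volume : Measure (Fin n → ℂ)).withDensity fun z =>
    ENNReal.ofReal ((t / Real.pi) ^ n * Real.exp (-t * fockNormSq z))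

/-- The Fock kernel `K_t(z, w) = e^{t⟨z, w⟩}`. -/
def fockKernel {n : ℕ} (t : ℝ) (z w : Fin n → ℂ) : ℂ :=
  Complex.exp ((t : ℂ) * fockInner z w)

/-- The absolute value `|K_t(z, w)| = |e^{t⟨z, w⟩}|` of the Fock kernel. -/
def absFockKernel {n : ℕ} (t : ℝ) (z w : Fin n → ℂ) : ℂ :=
  ((‖fockKernel t z w‖ : ℝ) : ℂ)

section IntegralOperators

variable {X : Type*} [MeasurableSpace X]

/-- The integral `∫ K(x, y) f(y) dν(y)` converges absolutely for `μ`-almost every `x`. -/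
def KernelConverges (K : X → X → ℂ) (ν μ : Measure X) (f : X → ℂ) : Prop :=
  ∀ᵐ x ∂μ, Integrable (fun y => K x y * f y) ν

/-- The integral operator `f ↦ ∫ K(·, y) f(y) dν(y)`. -/
def kernelOp (K : X → X → ℂ) (ν : Measure X) (f : X → ℂ) (x : X) : ℂ :=
  ∫ y, K x y * f y ∂ν

/-- The bounded operator `B` on `L^p(μ)` is the integral operator with kernel `K` with respect
to `ν`: for every `f ∈ L^p(μ)` the defining integral converges absolutely at almost every point
and is equal to `B f` almost everywhere. -/
def IsIntegralOperator (K : X → X → ℂ) (ν μ : Measure X) (p : ℝ≥0∞) [Fact (1 ≤ p)]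
    (B : Lp ℂ p μ →L[ℂ] Lp ℂ p μ) : Prop :=
  ∀ f : Lp ℂ p μ, KernelConverges K ν μ f ∧ B f =ᵐ[μ] kernelOp K ν f

/-- The integral operator with kernel `K` with respect to `ν` is defined on all of `L^p(μ)`
and is a bounded operator on `L^p(μ)`. -/
def IntegralOperatorBounded (K : X → X → ℂ) (ν μ : Measure X) (p : ℝ≥0∞) [Fact (1 ≤ p)] : Prop :=
  ∃ B : Lp ℂ p μ →L[ℂ] Lp ℂ p μ, IsIntegralOperator K ν μ p B

/-- The integral operator with kernel `K` with respect to `ν`, considered only on its natural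
domain of all `f ∈ L^p(μ)` for which the defining integral converges absolutely at almost every
point, extends to a bounded operator on `L^p(μ)`. -/
def IntegralOperatorExtendsBounded (K : X → X → ℂ) (ν μ : Measure X) (p : ℝ≥0∞)
    [Fact (1 ≤ p)] : Prop :=
  ∃ B : Lp ℂ p μ →L[ℂ] Lp ℂ p μ,
    ∀ f : Lp ℂ p μ, KernelConverges K ν μ f → B f =ᵐ[μ] kernelOp K ν f

end IntegralOperators

end

open MeasureTheory
open scoped ENNReal

noncomputable section

/-! If pt = 2s, multiplication by e^{-t|w|²/2} carries L^p(dv_s) onto L^p(dv), isometrically up to a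
constant factor, and turns T_t into convolution with (t/π)^n e^{-t|z|²/2}, whose mass is 2^n.
Schur's test (`lintegral_lintegral_mul_rpow_le`) then gives the bound 2^n for every p ≥ 1 at once,
and S_t follows from |S_t f| ≤ T_t|f|. Gaussians that become constant in the limit after this
multiplication show that 2^n is sharp (`two_pow_le_norm_of_isIntegralOperator`).

Conversely, S_t sends e^{-x|w|² + ∑ cᵢwᵢ} to a multiple of e^{(t/(t+x)) ∑ cᵢzᵢ}. Both norms are
explicit, and letting |c| → ∞ compares their exponents: t²(s+px) ≤ s(t+x)². Equality holds at x = 0,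
so the derivatives there agree, which is pt = 2s (`mul_eq_of_eLpNorm_kernelOp_fockKernel_le`). The
test functions lie in the natural domain, so (a') and (b') suffice; (a') is used through |S_t f| ≤
T_t|f|. -/

theorem integral_cexp_neg_mul_sq_add_conj {b : ℝ} (hb : 0 < b) (c d : ℂ) :
    Integrable (fun w : ℂ => Complex.exp (-b * (‖w‖ : ℂ) ^ 2 + (c * w + d * (starRingEnd ℂ) w))) ∧
    ∫ w : ℂ, Complex.exp (-b * (‖w‖ : ℂ) ^ 2 + (c * w + d * (starRingEnd ℂ) w)) =
      Real.pi / b * Complex.exp (c * d / b) := by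
  have hb0 : (b : ℂ) ≠ 0 := by exact_mod_cast hb.ne'
  have hre : (-(b : ℂ)).re < 0 := by simpa using hb
  -- In real and imaginary parts the integrand splits into two one-variable Gaussians with linear
  -- coefficients c + d and i(c - d); (c + d)² - (c - d)² = 4cd gives the final exponent.
  have hfun : (fun q : ℝ × ℝ => Complex.exp (-b * (‖Complex.measurableEquivRealProd.symm q‖ : ℂ) ^ 2
      + (c * Complex.measurableEquivRealProd.symm q +
        d * (starRingEnd ℂ) (Complex.measurableEquivRealProd.symm q)))) =
      fun q : ℝ × ℝ => Complex.exp (-(b : ℂ) * q.1 ^ 2 + (c + d) * q.1 + 0) *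
        Complex.exp (-(b : ℂ) * q.2 ^ 2 + (Complex.I * (c - d)) * q.2 + 0) := by
    funext q
    have h1 : Complex.measurableEquivRealProd.symm q = (q.1 : ℂ) + q.2 * Complex.I := by
      apply Complex.ext <;> simp [Complex.measurableEquivRealProd]
    have h2 : (starRingEnd ℂ) (Complex.measurableEquivRealProd.symm q) =
        (q.1 : ℂ) - q.2 * Complex.I := by
      rw [h1]; simp [sub_eq_add_neg]
    rw [← Complex.mul_conj', h2, h1, ← Complex.exp_add]
    congr 1
    linear_combination (-b * q.2 ^ 2 * -1 : ℂ) * Complex.I_sq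
  have hmp := Complex.volume_preserving_equiv_real_prod.symm
  have hme : MeasurableEmbedding Complex.measurableEquivRealProd.symm :=
    MeasurableEquiv.measurableEmbedding _
  constructor
  · rw [← hmp.integrable_comp_emb hme, Function.comp_def, hfun]
    exact (integrable_cexp_quadratic (b := b) (by simpa using hb) _ _).mul_prod
      (integrable_cexp_quadratic (b := b) (by simpa using hb) _ _)
  · rw [← hmp.integral_comp hme, hfun, Measure.volume_eq_prod,
      integral_prod_mul (fun x : ℝ => Complex.exp (-(b : ℂ) * x ^ 2 + (c + d) * x + 0))
        (fun x : ℝ => Complex.exp (-(b : ℂ) * x ^ 2 + (Complex.I * (c - d)) * x + 0)),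
      integral_cexp_quadratic hre, integral_cexp_quadratic hre, neg_neg, mul_mul_mul_comm,
      ← Complex.exp_add, ← pow_two, one_div, Complex.cpow_ofNat_inv_pow]
    congr 2
    field_simp
    linear_combination ((c - d) ^ 2 : ℂ) * Complex.I_sq

/-- The exponential `e^{-b|w|² + ∑ cᵢ wᵢ + ∑ dᵢ w̄ᵢ}` on `ℂⁿ`. -/
def gaussExp {n : ℕ} (b : ℝ) (c d : Fin n → ℂ) (w : Fin n → ℂ) : ℂ :=
  Complex.exp (-b * (fockNormSq w : ℂ) + ∑ i, (c i * w i + d i * (starRingEnd ℂ) (w i)))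

/-! ### Calculus of Gaussian exponentials on ℂⁿ -/

section GaussExp

variable {n : ℕ}

theorem continuous_fockNormSq : Continuous (fockNormSq : (Fin n → ℂ) → ℝ) := by
  unfold fockNormSq; fun_prop

theorem continuous_gaussExp (b : ℝ) (c d : Fin n → ℂ) : Continuous (gaussExp b c d) := by
  have := continuous_fockNormSq (n := n)
  unfold gaussExp
  fun_prop

theorem gaussExp_eq_prod (b : ℝ) (c d w : Fin n → ℂ) :
    gaussExp b c d w = ∏ i, Complex.exp (-b * (‖w i‖ : ℂ) ^ 2 +
      (c i * w i + d i * (starRingEnd ℂ) (w i))) := by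
  rw [gaussExp, ← Complex.exp_sum, Finset.sum_add_distrib (f := fun i => -b * (‖w i‖ : ℂ) ^ 2),
    ← Finset.mul_sum]
  simp [fockNormSq]

theorem gaussExp_mul (b b' : ℝ) (c d c' d' w : Fin n → ℂ) :
    gaussExp b c d w * gaussExp b' c' d' w = gaussExp (b + b') (c + c') (d + d') w := by
  simp only [gaussExp, ← Complex.exp_add, Pi.add_apply, add_mul, Finset.sum_add_distrib]
  congr 1
  push_cast
  ring

theorem norm_gaussExp (b : ℝ) (c d w : Fin n → ℂ) :
    ‖gaussExp b c d w‖ = Real.exp (-b * fockNormSq w +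
      ∑ i, ((c i + (starRingEnd ℂ) (d i)) * w i).re) := by
  rw [gaussExp, Complex.norm_exp]
  congr 1
  rw [Complex.add_re, Complex.re_sum]
  congr 1
  · rw [← Complex.ofReal_neg, ← Complex.ofReal_mul, Complex.ofReal_re]
  · refine Finset.sum_congr rfl fun i _ => ?_
    simp
    ring

/-- The real part of the exponent is again of the same shape, so integrals of moduli reduce to the
complex formula `integral_gaussExp`. -/
theorem ofReal_norm_gaussExp (b : ℝ) (c d w : Fin n → ℂ) :
    ((‖gaussExp b c d w‖ : ℝ) : ℂ) = gaussExp b (fun i => (c i + (starRingEnd ℂ) (d i)) / 2)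
      (fun i => ((starRingEnd ℂ) (c i) + d i) / 2) w := by
  rw [norm_gaussExp, gaussExp, Complex.ofReal_exp]
  congr 1
  push_cast
  congr 1
  refine Finset.sum_congr rfl fun i _ => ?_
  rw [Complex.re_eq_add_conj]
  simp
  ring

theorem norm_gaussExp_rpow (b : ℝ) (c d w : Fin n → ℂ) (q : ℝ) :
    ‖gaussExp b c d w‖ ^ q = ‖gaussExp (q * b) ((q : ℂ) • c) ((q : ℂ) • d) w‖ := by
  rw [norm_gaussExp, norm_gaussExp, ← Real.exp_mul]
  congr 1
  rw [add_mul, Finset.sum_mul]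
  congr 1
  · ring
  · refine Finset.sum_congr rfl fun i _ => ?_
    simp
    ring

theorem enorm_gaussExp_rpow (b : ℝ) (c d w : Fin n → ℂ) {q : ℝ} (hq : 0 ≤ q) :
    ‖gaussExp b c d w‖ₑ ^ q = ‖gaussExp (q * b) ((q : ℂ) • c) ((q : ℂ) • d) w‖ₑ := by
  rw [← ofReal_norm, ← ofReal_norm, ENNReal.ofReal_rpow_of_nonneg (norm_nonneg _) hq,
    norm_gaussExp_rpow]

theorem integrable_gaussExp {b : ℝ} (hb : 0 < b) (c d : Fin n → ℂ) :
    Integrable (gaussExp b c d) := by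
  have : gaussExp b c d = _ := funext (gaussExp_eq_prod b c d)
  rw [this]
  exact Integrable.fintype_prod fun i => (integral_cexp_neg_mul_sq_add_conj hb (c i) (d i)).1

theorem integral_gaussExp {b : ℝ} (hb : 0 < b) (c d : Fin n → ℂ) :
    ∫ w, gaussExp b c d w = (Real.pi / b) ^ n * Complex.exp ((∑ i, c i * d i) / b) := by
  simp_rw [gaussExp_eq_prod]
  rw [integral_fintype_prod_volume_eq_prod (fun i (w : ℂ) => Complex.exp (-b * (‖w‖ : ℂ) ^ 2 +
      (c i * w + d i * (starRingEnd ℂ) w)))]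
  simp_rw [(integral_cexp_neg_mul_sq_add_conj hb _ _).2]
  rw [Finset.prod_mul_distrib, ← Complex.exp_sum, Finset.sum_div, Finset.prod_const,
    Finset.card_univ, Fintype.card_fin]

theorem lintegral_enorm_gaussExp {b : ℝ} (hb : 0 < b) (c d : Fin n → ℂ) :
    ∫⁻ w, ‖gaussExp b c d w‖ₑ = ENNReal.ofReal ((Real.pi / b) ^ n *
      Real.exp (fockNormSq (fun i => c i + (starRingEnd ℂ) (d i)) / (4 * b))) := by
  simp_rw [← ofReal_norm]
  rw [← ofReal_integral_eq_lintegral_ofReal (integrable_gaussExp hb c d).norm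
    (Filter.Eventually.of_forall fun _ => norm_nonneg _)]
  congr 1
  rw [← Complex.ofReal_inj, ← integral_complex_ofReal]
  simp_rw [ofReal_norm_gaussExp]
  rw [integral_gaussExp hb]
  push_cast [fockNormSq]
  congr 2
  rw [Finset.sum_div, Finset.sum_div]
  refine Finset.sum_congr rfl fun i _ => ?_
  rw [← Complex.mul_conj']
  simp
  ring

theorem enorm_gaussExp_zero (b : ℝ) (w : Fin n → ℂ) :
    ‖gaussExp b 0 0 w‖ₑ = ENNReal.ofReal (Real.exp (-b * fockNormSq w)) := by
  rw [← ofReal_norm, norm_gaussExp]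
  simp

theorem lintegral_gaussianVol {t : ℝ} (ht : 0 < t) (F : (Fin n → ℂ) → ℝ≥0∞) :
    ∫⁻ w, F w ∂(gaussianVol n t) =
      ENNReal.ofReal ((t / Real.pi) ^ n) * ∫⁻ w, ‖gaussExp t 0 0 w‖ₑ * F w := by
  have hc := continuous_fockNormSq (n := n)
  have hπ := Real.pi_pos
  rw [gaussianVol, lintegral_withDensity_eq_lintegral_mul_non_measurable,
    ← lintegral_const_mul' _ _ ENNReal.ofReal_ne_top]
  · refine lintegral_congr fun w => ?_
    rw [Pi.mul_apply, ENNReal.ofReal_mul (by positivity), enorm_gaussExp_zero, mul_assoc]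
  · exact (Continuous.measurable (by fun_prop)).ennreal_ofReal
  · exact Filter.Eventually.of_forall fun _ => ENNReal.ofReal_lt_top

theorem gaussianVol_absolutelyContinuous (t : ℝ) : gaussianVol n t ≪ volume :=
  withDensity_absolutelyContinuous _ _

theorem volume_absolutelyContinuous_gaussianVol {t : ℝ} (ht : 0 < t) :
    volume ≪ gaussianVol n t := by
  have hc := continuous_fockNormSq (n := n)
  have hπ := Real.pi_pos
  refine withDensity_absolutelyContinuous' ((Continuous.measurable (by fun_prop)).ennreal_ofReal.aemeasurable)
    (Filter.Eventually.of_forall fun w => ?_)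
  rw [Ne, ENNReal.ofReal_eq_zero, not_le]
  positivity

instance sFinite_gaussianVol (t : ℝ) : SFinite (gaussianVol n t) := by
  unfold gaussianVol; infer_instance

theorem integrable_integral_gaussianVol_gaussExp {t b : ℝ} (ht : 0 < t) (hb : 0 < t + b)
    (c d : Fin n → ℂ) :
    Integrable (gaussExp b c d) (gaussianVol n t) ∧
    ∫ w, gaussExp b c d w ∂(gaussianVol n t) =
      (t / (t + b) : ℝ) ^ n * Complex.exp ((∑ i, c i * d i) / (t + b : ℝ)) := by
  have hc := continuous_fockNormSq (n := n)
  have hπ := Real.pi_pos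
  have hm : Measurable fun z : Fin n → ℂ =>
      ENNReal.ofReal ((t / Real.pi) ^ n * Real.exp (-t * fockNormSq z)) :=
    (Continuous.measurable (by fun_prop)).ennreal_ofReal
  have hfin : ∀ᵐ z : Fin n → ℂ,
      ENNReal.ofReal ((t / Real.pi) ^ n * Real.exp (-t * fockNormSq z)) < ∞ :=
    Filter.Eventually.of_forall fun _ => ENNReal.ofReal_lt_top
  have key : ∀ z : Fin n → ℂ, (ENNReal.ofReal ((t / Real.pi) ^ n *
      Real.exp (-t * fockNormSq z))).toReal • gaussExp b c d z =
      ((t / Real.pi) ^ n : ℝ) * gaussExp (t + b) c d z := by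
    intro z
    have h : ((Real.exp (-t * fockNormSq z) : ℝ) : ℂ) = gaussExp t 0 0 z := by
      simp [gaussExp]
    rw [ENNReal.toReal_ofReal (by positivity), Complex.real_smul, Complex.ofReal_mul, h,
      mul_assoc, gaussExp_mul, zero_add, zero_add]
  rw [gaussianVol, integrable_withDensity_iff_integrable_smul' hm hfin,
    integral_withDensity_eq_integral_toReal_smul hm hfin]
  simp_rw [key]
  refine ⟨(integrable_gaussExp hb c d).const_mul _, ?_⟩
  rw [integral_const_mul, integral_gaussExp hb, ← mul_assoc]
  congr 1
  rw [← Complex.ofReal_div, ← Complex.ofReal_pow, ← Complex.ofReal_pow, ← Complex.ofReal_mul,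
    ← mul_pow]
  rw [div_mul_div_cancel₀ hπ.ne']

theorem lintegral_gaussianVol_enorm_gaussExp_rpow {s b q : ℝ} (hs : 0 < s) (hq : 0 ≤ q)
    (hb : 0 < s + q * b) (c d : Fin n → ℂ) :
    ∫⁻ w, ‖gaussExp b c d w‖ₑ ^ q ∂(gaussianVol n s) =
      ENNReal.ofReal ((s / (s + q * b)) ^ n * Real.exp (q ^ 2 *
        fockNormSq (fun i => c i + (starRingEnd ℂ) (d i)) / (4 * (s + q * b)))) := by
  have hπ := Real.pi_pos
  have key : ∀ w, ‖gaussExp s 0 0 w‖ₑ * ‖gaussExp b c d w‖ₑ ^ q =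
      ‖gaussExp (s + q * b) ((q : ℂ) • c) ((q : ℂ) • d) w‖ₑ := by
    intro w
    rw [enorm_gaussExp_rpow _ _ _ _ hq, ← enorm_mul, gaussExp_mul, zero_add, zero_add]
  rw [lintegral_gaussianVol hs]
  simp_rw [key]
  rw [lintegral_enorm_gaussExp hb, ← ENNReal.ofReal_mul (by positivity), ← mul_assoc, ← mul_pow]
  congr 2
  · congr 1
    field_simp
  · congr 2
    simp only [fockNormSq, Finset.mul_sum, Pi.smul_apply, smul_eq_mul, map_mul, Complex.conj_ofReal]
    refine Finset.sum_congr rfl fun i _ => ?_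
    rw [← mul_add, norm_mul, mul_pow]
    simp

end GaussExp

/-! ### Schur's test -/

section Schur

variable {X Y : Type*} [MeasurableSpace X] [MeasurableSpace Y]

theorem lintegral_mul_rpow_le {μ : Measure X} {k g : X → ℝ≥0∞} (hk : Measurable k)
    (hg : Measurable g) {q : ℝ} (hq : 1 ≤ q) :
    (∫⁻ x, k x * g x ∂μ) ^ q ≤ (∫⁻ x, k x ∂μ) ^ (q - 1) * ∫⁻ x, k x * g x ^ q ∂μ := by
  -- The conjugate exponent is infinite at q = 1; otherwise this is Hölder for the measure k dμ
  -- against the function 1.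
  rcases hq.eq_or_lt with rfl | hq
  · simp
  have hq0 : 0 < q := by linarith
  have hpq : q.HolderConjugate (q.conjExponent) := Real.HolderConjugate.conjExponent hq
  have h := ENNReal.lintegral_mul_le_Lp_mul_Lq (μ.withDensity k) hpq
    (f := g) (g := fun _ => 1) hg.aemeasurable aemeasurable_const
  simp only [Pi.mul_apply, mul_one, ENNReal.one_rpow] at h
  rw [lintegral_withDensity_eq_lintegral_mul _ hk hg,
    lintegral_withDensity_eq_lintegral_mul _ hk (hg.pow_const q),
    lintegral_withDensity_eq_lintegral_mul _ hk measurable_const] at h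
  simp only [Pi.mul_apply, mul_one] at h
  refine (ENNReal.rpow_le_rpow h hq0.le).trans_eq ?_
  rw [ENNReal.mul_rpow_of_nonneg _ _ hq0.le, ← ENNReal.rpow_mul, ← ENNReal.rpow_mul,
    one_div_mul_cancel hq0.ne', ENNReal.rpow_one, mul_comm]
  congr 2
  rw [Real.conjExponent]
  have : q - 1 ≠ 0 := by linarith
  field_simp

/-- Schur's test for a kernel both of whose marginals are bounded by the same constant. -/
theorem lintegral_lintegral_mul_rpow_le {μ : Measure X} {ν : Measure Y} [SFinite μ] [SFinite ν]
    {k : X → Y → ℝ≥0∞} (hk : Measurable (Function.uncurry k)) {A : ℝ≥0∞}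
    (hν : ∀ x, ∫⁻ y, k x y ∂ν ≤ A) (hμ : ∀ y, ∫⁻ x, k x y ∂μ ≤ A)
    {g : Y → ℝ≥0∞} (hg : Measurable g) {q : ℝ} (hq : 1 ≤ q) :
    ∫⁻ x, (∫⁻ y, k x y * g y ∂ν) ^ q ∂μ ≤ A ^ q * ∫⁻ y, g y ^ q ∂ν := by
  have hq1 : 0 ≤ q - 1 := by linarith
  calc ∫⁻ x, (∫⁻ y, k x y * g y ∂ν) ^ q ∂μ
      ≤ ∫⁻ x, A ^ (q - 1) * ∫⁻ y, k x y * g y ^ q ∂ν ∂μ := by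
        refine lintegral_mono fun x =>
          (lintegral_mul_rpow_le (k := k x) (hk.comp measurable_prodMk_left) hg hq).trans ?_
        gcongr
        exact hν x
    _ = A ^ (q - 1) * ∫⁻ y, (∫⁻ x, k x y ∂μ) * g y ^ q ∂ν := by
        rw [lintegral_const_mul, lintegral_lintegral_swap]
        · congr 1
          refine lintegral_congr fun y => ?_
          exact lintegral_mul_const _ (hk.comp measurable_prodMk_right)
        · exact (hk.mul ((hg.pow_const q).comp measurable_snd)).aemeasurable
        · exact (hk.mul ((hg.pow_const q).comp measurable_snd)).lintegral_prod_right
    _ ≤ A ^ (q - 1) * ∫⁻ y, A * g y ^ q ∂ν := by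
        gcongr
        exact hμ _
    _ = A ^ q * ∫⁻ y, g y ^ q ∂ν := by
        rw [lintegral_const_mul _ (hg.pow_const q), ← mul_assoc]
        congr 1
        nth_rewrite 2 [← ENNReal.rpow_one A]
        rw [← ENNReal.rpow_add_of_nonneg _ _ hq1 zero_le_one, sub_add_cancel]

end Schur

/-! ### Passing between kernel integrals and operators on L^p -/

section KernelOperators

variable {X : Type*} [MeasurableSpace X] {K : X → X → ℂ} {ν μ : Measure X} {p : ℝ≥0∞}

theorem kernelOp_congr {f g : X → ℂ} (h : f =ᵐ[ν] g) : kernelOp K ν f = kernelOp K ν g := by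
  funext x
  exact integral_congr_ae (h.mono fun y hy => by simp only [hy])

theorem KernelConverges.congr {f g : X → ℂ} (hf : KernelConverges K ν μ f) (h : f =ᵐ[ν] g) :
    KernelConverges K ν μ g := by
  filter_upwards [hf] with x hx
  exact hx.congr (h.mono fun y hy => by simp only [hy])

variable [Fact (1 ≤ p)]

theorem IntegralOperatorBounded.extends (h : IntegralOperatorBounded K ν μ p) :
    IntegralOperatorExtendsBounded K ν μ p := by
  obtain ⟨B, hB⟩ := h
  exact ⟨B, fun f _ => (hB f).2⟩

/-- Since ν ≪ μ, the kernel integral does not depend on the representative of an L^p class, so the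
operator bound applies to concrete test functions. -/
theorem eLpNorm_kernelOp_le (hac : ν ≪ μ) {B : Lp ℂ p μ →L[ℂ] Lp ℂ p μ}
    (hB : ∀ f : Lp ℂ p μ, KernelConverges K ν μ f → B f =ᵐ[μ] kernelOp K ν f)
    {f : X → ℂ} (hf : MemLp f p μ) (hc : KernelConverges K ν μ f) :
    eLpNorm (kernelOp K ν f) p μ ≤ ENNReal.ofReal ‖B‖ * eLpNorm f p μ := by
  have hfe : hf.toLp f =ᵐ[ν] f := hac.ae_le hf.coeFn_toLp
  have h := hB (hf.toLp f) (hc.congr hfe.symm)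
  rw [kernelOp_congr hfe] at h
  rw [← eLpNorm_congr_ae h, ← eLpNorm_congr_ae hf.coeFn_toLp, ofReal_norm]
  simpa [Lp.enorm_def] using B.le_opENorm (hf.toLp f)

/-- The integrals for K, f and for |K|, |f| converge absolutely together, and the first is dominated
by the second. -/
theorem eLpNorm_kernelOp_le_of_norm (hac : ν ≪ μ)
    {B : Lp ℂ p μ →L[ℂ] Lp ℂ p μ} (hB : ∀ f : Lp ℂ p μ,
      KernelConverges (fun x y => ((‖K x y‖ : ℝ) : ℂ)) ν μ f →
        B f =ᵐ[μ] kernelOp (fun x y => ((‖K x y‖ : ℝ) : ℂ)) ν f)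
    {f : X → ℂ} (hf : MemLp f p μ) (hc : KernelConverges K ν μ f) :
    eLpNorm (kernelOp K ν f) p μ ≤ ENNReal.ofReal ‖B‖ * eLpNorm f p μ := by
  have hc' : KernelConverges (fun x y => ((‖K x y‖ : ℝ) : ℂ)) ν μ
      (fun x => ((‖f x‖ : ℝ) : ℂ)) := by
    filter_upwards [hc] with x hx
    simpa using hx.norm.ofReal (𝕜 := ℂ)
  have h := eLpNorm_kernelOp_le hac hB (f := fun x => ((‖f x‖ : ℝ) : ℂ)) hf.norm.ofReal hc'
  have hn : eLpNorm (fun x => ((‖f x‖ : ℝ) : ℂ)) p μ = eLpNorm f p μ :=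
    eLpNorm_congr_norm_ae (Filter.Eventually.of_forall fun x => by simp)
  rw [← hn]
  refine le_trans (eLpNorm_mono fun x => ?_) h
  have : kernelOp (fun x y => ((‖K x y‖ : ℝ) : ℂ)) ν (fun x => ((‖f x‖ : ℝ) : ℂ)) x =
      ((∫ y, ‖K x y * f y‖ ∂ν : ℝ) : ℂ) := by
    rw [← integral_complex_ofReal]
    simp [kernelOp]
  rw [this, Complex.norm_real]
  exact (norm_integral_le_integral_norm _).trans (le_abs_self _)

theorem exists_isIntegralOperator [SFinite ν] (hp : p ≠ ∞) (hac : ν ≪ μ)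
    (hK : StronglyMeasurable (Function.uncurry K)) {C : ℝ} (hC : 0 ≤ C)
    (hb : ∀ f : X → ℂ, Measurable f → ∫⁻ x, (∫⁻ y, ‖K x y‖ₑ * ‖f y‖ₑ ∂ν) ^ p.toReal ∂μ ≤
      ENNReal.ofReal C ^ p.toReal * ∫⁻ x, ‖f x‖ₑ ^ p.toReal ∂μ) :
    ∃ B : Lp ℂ p μ →L[ℂ] Lp ℂ p μ, IsIntegralOperator K ν μ p B ∧ ‖B‖ ≤ C := by
  have hp1 : 1 ≤ p := Fact.out
  have hp0 : p ≠ 0 := (zero_lt_one.trans_le hp1).ne'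
  have hP : 0 < p.toReal := ENNReal.toReal_pos hp0 hp
  have hm : ∀ f : Lp ℂ p μ, StronglyMeasurable (fun q : X × X => K q.1 q.2 * f q.2) := fun f =>
    hK.mul ((Lp.stronglyMeasurable f).comp_measurable measurable_snd)
  have hb' : ∀ f : Lp ℂ p μ, ∫⁻ x, (∫⁻ y, ‖K x y * f y‖ₑ ∂ν) ^ p.toReal ∂μ ≤
      ENNReal.ofReal C ^ p.toReal * ∫⁻ x, ‖f x‖ₑ ^ p.toReal ∂μ := fun f => by
    simpa only [enorm_mul] using hb f (Lp.stronglyMeasurable f).measurable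
  have hconv : ∀ f : Lp ℂ p μ, KernelConverges K ν μ f := by
    intro f
    have hfin := lintegral_rpow_enorm_lt_top_of_eLpNorm_lt_top hp0 hp (Lp.memLp f).2
    have h := ((hb' f).trans_lt (ENNReal.mul_lt_top
      (ENNReal.rpow_lt_top_of_nonneg hP.le ENNReal.ofReal_ne_top) hfin)).ne
    have hmeas : Measurable fun x => (∫⁻ y, ‖K x y * f y‖ₑ ∂ν) ^ p.toReal :=
      ((hm f).enorm.lintegral_prod_right').pow_const _
    -- A finite integral of the p-th power forces the inner integral to be finite almost everywhere.
    filter_upwards [ae_lt_top hmeas h] with x hx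
    refine ⟨((hm f).comp_measurable measurable_prodMk_left).aestronglyMeasurable, ?_⟩
    by_contra hx'
    rw [HasFiniteIntegral, not_lt_top_iff] at hx'
    rw [hx', ENNReal.top_rpow_of_pos hP] at hx
    exact lt_irrefl _ hx
  have hle : ∀ f : Lp ℂ p μ, eLpNorm (kernelOp K ν f) p μ ≤ ENNReal.ofReal C * eLpNorm f p μ := by
    intro f
    rw [eLpNorm_eq_lintegral_rpow_enorm_toReal hp0 hp, eLpNorm_eq_lintegral_rpow_enorm_toReal hp0 hp,
      one_div, ENNReal.rpow_inv_le_iff hP, ENNReal.mul_rpow_of_nonneg _ _ hP.le,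
      ENNReal.rpow_inv_rpow hP.ne']
    refine le_trans (lintegral_mono fun x => ?_) (hb' f)
    exact ENNReal.rpow_le_rpow (enorm_integral_le_lintegral_enorm _) hP.le
  have hmem : ∀ f : Lp ℂ p μ, MemLp (kernelOp K ν f) p μ := fun f =>
    ⟨((hm f).integral_prod_right').aestronglyMeasurable,
      (hle f).trans_lt (ENNReal.mul_lt_top ENNReal.ofReal_lt_top (Lp.memLp f).2)⟩
  let L : Lp ℂ p μ →ₗ[ℂ] Lp ℂ p μ :=
    { toFun := fun f => (hmem f).toLp _
      map_add' := fun f g => by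
        rw [← MemLp.toLp_add]
        refine MemLp.toLp_congr _ _ ?_
        rw [kernelOp_congr (hac.ae_le (Lp.coeFn_add f g))]
        filter_upwards [hconv f, hconv g] with x hf hg
        simp only [kernelOp, Pi.add_apply, mul_add]
        exact integral_add hf hg
      map_smul' := fun c f => by
        rw [RingHom.id_apply, ← MemLp.toLp_const_smul]
        refine MemLp.toLp_congr _ _ (Filter.Eventually.of_forall fun x => ?_)
        rw [kernelOp_congr (hac.ae_le (Lp.coeFn_smul c f))]
        simp only [kernelOp, Pi.smul_apply, smul_eq_mul, ← integral_const_mul]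
        congr 1
        funext y
        ring }
  have hL : ∀ f, ‖L f‖ ≤ C * ‖f‖ := by
    intro f
    rw [Lp.norm_def, Lp.norm_def]
    nth_rewrite 1 [← ENNReal.toReal_ofReal hC]
    rw [← ENNReal.toReal_mul]
    refine ENNReal.toReal_mono (ENNReal.mul_ne_top ENNReal.ofReal_ne_top (Lp.memLp f).2.ne) ?_
    exact (eLpNorm_congr_ae (hmem f).coeFn_toLp).trans_le (hle f)
  exact ⟨L.mkContinuous C hL, fun f => ⟨hconv f, (hmem f).coeFn_toLp⟩,
    L.mkContinuous_norm_le hC hL⟩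

end KernelOperators

/-! ### The Fock kernel and sufficiency of pt = 2s -/

section FockKernel

variable {n : ℕ}

theorem fockKernel_eq_gaussExp (t : ℝ) (z w : Fin n → ℂ) :
    fockKernel t z w = gaussExp 0 0 ((t : ℂ) • z) w := by
  simp [fockKernel, gaussExp, fockInner, Finset.mul_sum, mul_assoc]

theorem absFockKernel_eq_gaussExp (t : ℝ) (z w : Fin n → ℂ) :
    absFockKernel t z w =
      gaussExp 0 (fun i => t * (starRingEnd ℂ) (z i) / 2) (fun i => t * z i / 2) w := by
  rw [absFockKernel, fockKernel_eq_gaussExp, ofReal_norm_gaussExp]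
  simp

theorem norm_fockKernel_comm (t : ℝ) (z w : Fin n → ℂ) :
    ‖fockKernel t z w‖ = ‖fockKernel t w z‖ := by
  have : fockKernel t w z = (starRingEnd ℂ) (fockKernel t z w) := by
    simp [fockKernel, fockInner, ← Complex.exp_conj, mul_comm]
  rw [this, RCLike.norm_conj]

theorem enorm_absFockKernel (t : ℝ) (z w : Fin n → ℂ) :
    ‖absFockKernel t z w‖ₑ = ‖fockKernel t z w‖ₑ := by
  rw [← ofReal_norm, ← ofReal_norm]
  simp [absFockKernel]

theorem continuous_fockKernel (t : ℝ) :
    Continuous (Function.uncurry (fockKernel t : (Fin n → ℂ) → (Fin n → ℂ) → ℂ)) := by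
  unfold fockKernel fockInner Function.uncurry
  fun_prop

theorem continuous_absFockKernel (t : ℝ) :
    Continuous (Function.uncurry (absFockKernel t : (Fin n → ℂ) → (Fin n → ℂ) → ℂ)) :=
  Complex.continuous_ofReal.comp (continuous_fockKernel t).norm

/-- Completing the square, the integrand is (t/π)^n e^{-t|z-w|²/2}, so its mass is independent of z.
-/
theorem lintegral_enorm_fockKernel_gaussian {t : ℝ} (ht : 0 < t) (z : Fin n → ℂ) :
    ∫⁻ w, ENNReal.ofReal ((t / Real.pi) ^ n) *
      (‖gaussExp (t / 2) 0 0 z‖ₑ * ‖fockKernel t z w‖ₑ * ‖gaussExp (t / 2) 0 0 w‖ₑ) =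
      ENNReal.ofReal (2 ^ n) := by
  have hπ := Real.pi_pos
  have key : ∀ w, ‖gaussExp (t / 2) 0 0 z‖ₑ * ‖fockKernel t z w‖ₑ * ‖gaussExp (t / 2) 0 0 w‖ₑ =
      ‖gaussExp (t / 2) 0 0 z‖ₑ * ‖gaussExp (t / 2) 0 ((t : ℂ) • z) w‖ₑ := fun w => by
    rw [mul_assoc, fockKernel_eq_gaussExp, ← enorm_mul, gaussExp_mul]
    simp
  simp_rw [key]
  rw [lintegral_const_mul' _ _ ENNReal.ofReal_ne_top, lintegral_const_mul' _ _ enorm_ne_top,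
    lintegral_enorm_gaussExp (by positivity), enorm_gaussExp_zero,
    ← ENNReal.ofReal_mul (by positivity), ← ENNReal.ofReal_mul (by positivity)]
  congr 1
  have h : fockNormSq (fun i => (0 : Fin n → ℂ) i + (starRingEnd ℂ) (((t : ℂ) • z) i)) =
      t ^ 2 * fockNormSq z := by
    simp [fockNormSq, Finset.mul_sum, mul_pow]
  rw [h, mul_left_comm (Real.exp _), ← Real.exp_add, ← mul_assoc, ← mul_pow]
  have h1 : t / Real.pi * (Real.pi / (t / 2)) = 2 := by field_simp
  have h2 : -(t / 2) * fockNormSq z + t ^ 2 * fockNormSq z / (4 * (t / 2)) = 0 := by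
    field_simp
    ring
  rw [h1, h2, Real.exp_zero, mul_one]

theorem lintegral_fockKernel_rpow_le {t s q : ℝ} (ht : 0 < t) (hs : 0 < s) (hq : 1 ≤ q)
    (hqt : q * t = 2 * s) {F : (Fin n → ℂ) → ℝ≥0∞} (hF : Measurable F) :
    ∫⁻ z, (∫⁻ w, ‖fockKernel t z w‖ₑ * F w ∂(gaussianVol n t)) ^ q ∂(gaussianVol n s) ≤
      ENNReal.ofReal (2 ^ n) ^ q * ∫⁻ w, F w ^ q ∂(gaussianVol n s) := by
  have hq0 : 0 ≤ q := by linarith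
  have hg : ∀ b : ℝ, Measurable fun w : Fin n → ℂ => ‖gaussExp b 0 0 w‖ₑ := fun b =>
    (continuous_gaussExp b 0 0).measurable.enorm
  have hmul : ∀ (b b' : ℝ) (w : Fin n → ℂ), ‖gaussExp b 0 0 w‖ₑ * ‖gaussExp b' 0 0 w‖ₑ =
      ‖gaussExp (b + b') 0 0 w‖ₑ := fun b b' w => by
    rw [← enorm_mul, gaussExp_mul, zero_add]
  have hpow : ∀ (b : ℝ) (w : Fin n → ℂ), ‖gaussExp b 0 0 w‖ₑ ^ q = ‖gaussExp (q * b) 0 0 w‖ₑ :=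
    fun b w => by rw [enorm_gaussExp_rpow _ _ _ _ hq0, smul_zero]
  have hone : ∀ w : Fin n → ℂ, ‖gaussExp 0 0 0 w‖ₑ = 1 := fun w => by
    simp [enorm_gaussExp_zero]
  set k : (Fin n → ℂ) → (Fin n → ℂ) → ℝ≥0∞ := fun z w => ENNReal.ofReal ((t / Real.pi) ^ n) *
    (‖gaussExp (t / 2) 0 0 z‖ₑ * ‖fockKernel t z w‖ₑ * ‖gaussExp (t / 2) 0 0 w‖ₑ) with hk
  have hkm : Measurable (Function.uncurry k) :=
    ((((hg _).comp measurable_fst).mul (continuous_fockKernel t).measurable.enorm).mul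
      ((hg _).comp measurable_snd)).const_mul _
  have hk1 : ∀ z, ∫⁻ w, k z w ≤ ENNReal.ofReal (2 ^ n) := fun z =>
    (lintegral_enorm_fockKernel_gaussian ht z).le
  have hk2 : ∀ w, ∫⁻ z, k z w ≤ ENNReal.ofReal (2 ^ n) := fun w => by
    refine (lintegral_congr fun z => ?_).trans_le (hk1 w)
    simp only [hk]
    rw [← ofReal_norm (fockKernel t z w), norm_fockKernel_comm, ofReal_norm]
    ring
  have hinner : ∀ z, ∫⁻ w, ‖fockKernel t z w‖ₑ * F w ∂(gaussianVol n t) =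
      ‖gaussExp (-(t / 2)) 0 0 z‖ₑ * ∫⁻ w, k z w * (‖gaussExp (t / 2) 0 0 w‖ₑ * F w) := by
    intro z
    rw [lintegral_gaussianVol ht, ← lintegral_const_mul' _ _ ENNReal.ofReal_ne_top,
      ← lintegral_const_mul' _ _ enorm_ne_top]
    refine lintegral_congr fun w => ?_
    have h1 : ‖gaussExp t 0 0 w‖ₑ = ‖gaussExp (t / 2) 0 0 w‖ₑ * ‖gaussExp (t / 2) 0 0 w‖ₑ := by
      rw [hmul, add_halves]
    have h2 : ‖gaussExp (-(t / 2)) 0 0 z‖ₑ * ‖gaussExp (t / 2) 0 0 z‖ₑ = 1 := by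
      rw [hmul, neg_add_cancel, hone]
    calc _ = (‖gaussExp (-(t / 2)) 0 0 z‖ₑ * ‖gaussExp (t / 2) 0 0 z‖ₑ) *
          (ENNReal.ofReal ((t / Real.pi) ^ n) *
            (‖gaussExp t 0 0 w‖ₑ * (‖fockKernel t z w‖ₑ * F w))) := by rw [h2, one_mul]
      _ = _ := by simp only [hk]; rw [h1]; ring
  -- The relation qt = 2s enters here: the q-th power of e^{-t|w|²/2} is exactly the weight
  -- e^{-s|w|²}.
  have hs1 : q * -(t / 2) = -s := by linarith
  have hs2 : q * (t / 2) = s := by linarith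
  rw [lintegral_gaussianVol hs, lintegral_gaussianVol hs, mul_left_comm]
  gcongr
  calc ∫⁻ z, ‖gaussExp s 0 0 z‖ₑ *
        (∫⁻ w, ‖fockKernel t z w‖ₑ * F w ∂(gaussianVol n t)) ^ q
      = ∫⁻ z, (∫⁻ w, k z w * (‖gaussExp (t / 2) 0 0 w‖ₑ * F w)) ^ q := by
        refine lintegral_congr fun z => ?_
        rw [hinner, ENNReal.mul_rpow_of_nonneg _ _ hq0, ← mul_assoc, hpow, hs1, hmul,
          add_neg_cancel, hone, one_mul]
    _ ≤ ENNReal.ofReal (2 ^ n) ^ q * ∫⁻ w, (‖gaussExp (t / 2) 0 0 w‖ₑ * F w) ^ q :=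
        lintegral_lintegral_mul_rpow_le hkm hk1 hk2 ((hg _).mul hF) hq
    _ = _ := by
        congr 1
        refine lintegral_congr fun w => ?_
        rw [ENNReal.mul_rpow_of_nonneg _ _ hq0, hpow, hs2]

/-! ### Gaussian test functions and their images -/

variable {p : ℝ≥0∞}

theorem eLpNorm_gaussExp {s b : ℝ} (hs : 0 < s) (hp0 : p ≠ 0) (hp : p ≠ ∞)
    (hb : 0 < s + p.toReal * b) (c d : Fin n → ℂ) :
    eLpNorm (gaussExp b c d) p (gaussianVol n s) =
      ENNReal.ofReal (((s / (s + p.toReal * b)) ^ n) ^ (1 / p.toReal) * Real.exp (p.toReal *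
        fockNormSq (fun i => c i + (starRingEnd ℂ) (d i)) / (4 * (s + p.toReal * b)))) := by
  have hP : 0 < p.toReal := ENNReal.toReal_pos hp0 hp
  rw [eLpNorm_eq_lintegral_rpow_enorm_toReal hp0 hp,
    lintegral_gaussianVol_enorm_gaussExp_rpow hs hP.le hb,
    ENNReal.ofReal_rpow_of_nonneg (by positivity) (by positivity),
    Real.mul_rpow (by positivity) (by positivity), ← Real.exp_mul]
  congr 3
  field_simp

theorem memLp_gaussExp {s b : ℝ} (hs : 0 < s) (hp0 : p ≠ 0) (hp : p ≠ ∞)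
    (hb : 0 < s + p.toReal * b) (c d : Fin n → ℂ) :
    MemLp (gaussExp b c d) p (gaussianVol n s) :=
  ⟨(continuous_gaussExp b c d).aestronglyMeasurable, by
    rw [eLpNorm_gaussExp hs hp0 hp hb]; exact ENNReal.ofReal_lt_top⟩

theorem kernelConverges_fockKernel_gaussExp {t b : ℝ} (ht : 0 < t) (hb : 0 < t + b)
    (c d : Fin n → ℂ) (μ : Measure (Fin n → ℂ)) :
    KernelConverges (fockKernel t) (gaussianVol n t) μ (gaussExp b c d) := by
  refine Filter.Eventually.of_forall fun z => ?_
  simp_rw [fockKernel_eq_gaussExp, gaussExp_mul, zero_add]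
  exact (integrable_integral_gaussianVol_gaussExp ht hb _ _).1

/-- The image has no Gaussian factor because the kernel is holomorphic in z. Negative b > -t is
allowed, which the necessity argument needs. -/
theorem kernelOp_fockKernel_gaussExp {t b : ℝ} (ht : 0 < t) (hb : 0 < t + b) (c : Fin n → ℂ) :
    kernelOp (fockKernel t) (gaussianVol n t) (gaussExp b c 0) =
      ((t / (t + b) : ℝ) ^ n : ℂ) • gaussExp 0 (((t / (t + b) : ℝ) : ℂ) • c) 0 := by
  funext z
  simp_rw [kernelOp, fockKernel_eq_gaussExp, gaussExp_mul, zero_add, add_zero]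
  rw [(integrable_integral_gaussianVol_gaussExp ht hb _ _).2, Pi.smul_apply, smul_eq_mul]
  congr 1
  simp only [gaussExp, Finset.sum_div]
  simp
  congr 1
  refine Finset.sum_congr rfl fun i _ => ?_
  ring

theorem kernelOp_absFockKernel_gaussExp {t b : ℝ} (ht : 0 < t) (hb : 0 < t + b) :
    kernelOp (absFockKernel t) (gaussianVol n t) (gaussExp b 0 0) =
      ((t / (t + b) : ℝ) ^ n : ℂ) • gaussExp (-(t ^ 2 / (4 * (t + b)))) 0 0 := by
  funext z
  simp_rw [kernelOp, absFockKernel_eq_gaussExp, gaussExp_mul, zero_add, add_zero]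
  rw [(integrable_integral_gaussianVol_gaussExp ht hb _ _).2, Pi.smul_apply, smul_eq_mul]
  congr 1
  simp only [gaussExp, fockNormSq, Finset.sum_div]
  simp [Finset.mul_sum]
  congr 1
  refine Finset.sum_congr rfl fun i _ => ?_
  rw [← Complex.mul_conj']
  field_simp
  ring

/-! ### Necessity of pt = 2s -/

theorem le_of_mul_exp_le_mul_exp {A D α β : ℝ} (hA : 0 < A)
    (h : ∀ y : ℝ, 0 ≤ y → A * Real.exp (α * y) ≤ D * Real.exp (β * y)) : α ≤ β := by
  by_contra! hlt
  have hD : 0 < D := by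
    have := h 0 le_rfl
    simp at this
    linarith
  have hδ : 0 < α - β := sub_pos.2 hlt
  -- With A(α - β)y = D, the bound e^u ≥ 1 + u gives A e^{(α-β)y} ≥ D + A > D.
  have h1 := h (D / (A * (α - β))) (by positivity)
  set y := D / (A * (α - β)) with hy
  have hyA : A * ((α - β) * y) = D := by rw [hy]; field_simp
  have h2 : Real.exp (α * y) = Real.exp ((α - β) * y) * Real.exp (β * y) := by
    rw [← Real.exp_add]; ring_nf
  rw [h2, ← mul_assoc] at h1
  have h3 := le_of_mul_le_mul_right h1 (Real.exp_pos _)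
  have h4 := Real.add_one_le_exp ((α - β) * y)
  nlinarith

/-- Expanding leaves t(qt - 2s)x ≤ sx² for small x of either sign, so the linear coefficient
vanishes. -/
theorem mul_eq_of_forall_quadratic {t s q : ℝ} (ht : 0 < t) (hs : 0 < s) (hq : 0 < q)
    (h : ∀ x : ℝ, 0 < t + x → 0 < s + q * x → t ^ 2 * (s + q * x) ≤ s * (t + x) ^ 2) :
    q * t = 2 * s := by
  have hbd : ∀ ε : ℝ, 0 < ε → ε < t → q * ε < s → |t * (q * t - 2 * s)| ≤ s * ε := by
    intro ε h0 h1 h2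
    have hp := h ε (by linarith) (by positivity)
    have hm := h (-ε) (by linarith) (by linarith)
    rw [abs_le]
    constructor
    · refine le_of_mul_le_mul_left ?_ h0
      linarith
    · refine le_of_mul_le_mul_left ?_ h0
      linarith
  by_contra hne
  have hδ : 0 < |t * (q * t - 2 * s)| := abs_pos.2 (mul_ne_zero ht.ne' (sub_ne_zero.2 hne))
  set δ := |t * (q * t - 2 * s)|
  -- The first two bounds make ±ε admissible; the third gives sε ≤ δ/2 < δ.
  have hε : 0 < min (t / 2) (min (s / (2 * q)) (δ / (2 * s))) := by positivity
  have h1 : min (t / 2) (min (s / (2 * q)) (δ / (2 * s))) ≤ t / 2 := min_le_left _ _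
  have h2 : min (t / 2) (min (s / (2 * q)) (δ / (2 * s))) ≤ s / (2 * q) :=
    (min_le_right _ _).trans (min_le_left _ _)
  have h3 : min (t / 2) (min (s / (2 * q)) (δ / (2 * s))) ≤ δ / (2 * s) :=
    (min_le_right _ _).trans (min_le_right _ _)
  set ε := min (t / 2) (min (s / (2 * q)) (δ / (2 * s)))
  rw [le_div_iff₀ (by positivity)] at h2 h3
  have := hbd ε hε (by linarith) (by linarith)
  linarith

theorem mul_eq_of_eLpNorm_kernelOp_fockKernel_le {t s C : ℝ} (hn : 1 ≤ n) (ht : 0 < t)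
    (hs : 0 < s) (hp0 : p ≠ 0) (hp : p ≠ ∞)
    (h : ∀ f : (Fin n → ℂ) → ℂ, MemLp f p (gaussianVol n s) →
      KernelConverges (fockKernel t) (gaussianVol n t) (gaussianVol n s) f →
      eLpNorm (kernelOp (fockKernel t) (gaussianVol n t) f) p (gaussianVol n s) ≤
        ENNReal.ofReal C * eLpNorm f p (gaussianVol n s)) :
    p.toReal * t = 2 * s := by
  have hP : 0 < p.toReal := ENNReal.toReal_pos hp0 hp
  have hn0 : (0 : ℝ) < n := by exact_mod_cast hn
  refine mul_eq_of_forall_quadratic ht hs hP fun x hx1 hx2 => ?_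
  have hs0 : 0 < s + p.toReal * 0 := by simpa using hs
  have key : p.toReal * (t / (t + x)) ^ 2 / (4 * s) ≤ p.toReal / (4 * (s + p.toReal * x)) := by
    -- Here y = |c|², realised by equal coordinates √(y/n), which needs n ≥ 1. The sign of C is
    -- unknown, hence `max C 0`.
    refine le_of_mul_exp_le_mul_exp (A := (t / (t + x)) ^ n)
      (D := max C 0 * ((s / (s + p.toReal * x)) ^ n) ^ (1 / p.toReal)) (by positivity) ?_
    intro y hy
    have hc : fockNormSq (fun _ : Fin n => ((√(y / n) : ℝ) : ℂ)) = y := by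
      simp only [fockNormSq, Complex.norm_real, Real.norm_eq_abs, sq_abs,
        Real.sq_sqrt (show 0 ≤ y / n by positivity), Finset.sum_const, Finset.card_univ,
        Fintype.card_fin, nsmul_eq_mul]
      field_simp
    have hb := h _ (memLp_gaussExp hs hp0 hp hx2 (fun _ : Fin n => ((√(y / n) : ℝ) : ℂ)) 0)
      (kernelConverges_fockKernel_gaussExp ht hx1 _ _ _)
    have hnorm : ‖((t / (t + x) : ℝ) ^ n : ℂ)‖ₑ = ENNReal.ofReal ((t / (t + x)) ^ n) := by
      rw [← ofReal_norm, norm_pow, Complex.norm_real, Real.norm_of_nonneg (by positivity)]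
    have hc' : fockNormSq (fun i => (((t / (t + x) : ℝ) : ℂ) •
        (fun _ : Fin n => ((√(y / n) : ℝ) : ℂ))) i + (starRingEnd ℂ) ((0 : Fin n → ℂ) i)) =
        (t / (t + x)) ^ 2 * y := by
      refine Eq.trans ?_ (congrArg ((t / (t + x)) ^ 2 * ·) hc)
      simp only [fockNormSq, Finset.mul_sum]
      refine Finset.sum_congr rfl fun i _ => ?_
      rw [Pi.smul_apply, Pi.zero_apply, map_zero, add_zero, norm_smul, mul_pow, Complex.norm_real,
        Real.norm_eq_abs, sq_abs]
    rw [kernelOp_fockKernel_gaussExp ht hx1, eLpNorm_const_smul, hnorm,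
      eLpNorm_gaussExp hs hp0 hp hs0, eLpNorm_gaussExp hs hp0 hp hx2, hc',
      ← ENNReal.ofReal_mul (by positivity)] at hb
    have hb' := hb.trans (mul_le_mul_left (ENNReal.ofReal_le_ofReal (le_max_left C 0)) _)
    rw [← ENNReal.ofReal_mul (by positivity), ENNReal.ofReal_le_ofReal_iff (by positivity)] at hb'
    simp only [Pi.zero_apply, map_zero, add_zero, hc, mul_zero, div_self hs.ne', one_pow,
      Real.one_rpow, one_mul] at hb'
    convert hb' using 1
    · congr 2
      ring
    · rw [mul_assoc]
      congr 3
      ring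
  rw [div_le_div_iff₀ (by positivity) (by positivity), div_pow] at key
  field_simp at key
  linarith

/-! ### Operator norms -/

variable [Fact (1 ≤ p)]

/-- The test function e^{(t/2-ε)|w|²} becomes e^{-ε|w|²} after multiplication by e^{-t|w|²/2};
convolution with a kernel of mass 2^n nearly multiplies it by 2^n as ε → 0. -/
theorem two_pow_le_norm_of_isIntegralOperator {t s : ℝ} (ht : 0 < t) (hs : 0 < s) (hp : p ≠ ∞)
    (hpt : p.toReal * t = 2 * s)
    {T : Lp ℂ p (gaussianVol n s) →L[ℂ] Lp ℂ p (gaussianVol n s)}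
    (hT : IsIntegralOperator (absFockKernel t) (gaussianVol n t) (gaussianVol n s) p T) :
    2 ^ n ≤ ‖T‖ := by
  have hp1 : 1 ≤ p := Fact.out
  have hp0 : p ≠ 0 := (zero_lt_one.trans_le hp1).ne'
  have hP : 0 < p.toReal := ENNReal.toReal_pos hp0 hp
  have hac : gaussianVol n t ≪ gaussianVol n s :=
    (gaussianVol_absolutelyContinuous t).trans (volume_absolutelyContinuous_gaussianVol hs)
  have key : ∀ ε : ℝ, 0 < ε → (t / (t / 2 + ε)) ^ n ≤ ‖T‖ := by
    intro ε hε
    have hx : t + (ε - t / 2) = t / 2 + ε := by ring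
    have hx1 : 0 < t + (ε - t / 2) := by rw [hx]; positivity
    have e1 : s + p.toReal * (ε - t / 2) = p.toReal * ε := by linarith
    have e2 : s + p.toReal * (-(t ^ 2 / (4 * (t / 2 + ε)))) =
        p.toReal * ε * (t / (t + 2 * ε)) := by
      have : s = p.toReal * t / 2 := by linarith
      rw [this]
      field_simp
      ring
    have hm := memLp_gaussExp (n := n) hs hp0 hp (b := ε - t / 2) (by rw [e1]; positivity) 0 0
    have hconv : KernelConverges (absFockKernel t) (gaussianVol n t) (gaussianVol n s)
        (gaussExp (ε - t / 2) 0 0) :=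
      (hT hm.toLp).1.congr (hac.ae_le hm.coeFn_toLp)
    have hb := eLpNorm_kernelOp_le hac (fun f _ => (hT f).2) hm hconv
    have hnorm : ‖((t / (t / 2 + ε) : ℝ) ^ n : ℂ)‖ₑ = ENNReal.ofReal ((t / (t / 2 + ε)) ^ n) := by
      rw [← ofReal_norm, norm_pow, Complex.norm_real, Real.norm_of_nonneg (by positivity)]
    rw [kernelOp_absFockKernel_gaussExp ht hx1, hx, eLpNorm_const_smul, hnorm,
      eLpNorm_gaussExp hs hp0 hp (by rw [e2]; positivity),
      eLpNorm_gaussExp hs hp0 hp (by rw [e1]; positivity), e1, e2,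
      ← ENNReal.ofReal_mul (by positivity), ← ENNReal.ofReal_mul (by positivity),
      ENNReal.ofReal_le_ofReal_iff (by positivity)] at hb
    have hz : fockNormSq (fun i => (0 : Fin n → ℂ) i + (starRingEnd ℂ) ((0 : Fin n → ℂ) i)) = 0 := by
      simp [fockNormSq]
    rw [hz, mul_zero, zero_div, zero_div, Real.exp_zero, mul_one, mul_one] at hb
    refine le_of_mul_le_mul_right (le_trans ?_ hb)
      (show 0 < ((s / (p.toReal * ε)) ^ n) ^ (1 / p.toReal) by positivity)
    -- The Gaussian in the image decays no faster than the test function, so its norm is at least as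
    -- large and only the constant factor matters.
    have hle : p.toReal * ε * (t / (t + 2 * ε)) ≤ p.toReal * ε := by
      refine mul_le_of_le_one_right (by positivity) ?_
      rw [div_le_one (by positivity)]
      linarith
    gcongr
  have hlim : Filter.Tendsto (fun ε : ℝ => (t / (t / 2 + ε)) ^ n) (nhdsWithin 0 (Set.Ioi 0))
      (nhds ((t / (t / 2 + 0)) ^ n)) := by
    refine Filter.Tendsto.mono_left (ContinuousAt.tendsto ?_) nhdsWithin_le_nhds
    refine ContinuousAt.pow (ContinuousAt.div₀ continuousAt_const (by fun_prop) ?_) n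
    positivity
  have h2 : t / (t / 2 + 0) = 2 := by field_simp; simp
  rw [h2] at hlim
  exact le_of_tendsto hlim (Filter.eventually_of_mem self_mem_nhdsWithin fun ε hε => key ε hε)

theorem norm_le_norm_of_isIntegralOperator {t s : ℝ} (hs : 0 < s)
    {T S : Lp ℂ p (gaussianVol n s) →L[ℂ] Lp ℂ p (gaussianVol n s)}
    (hT : IsIntegralOperator (absFockKernel t) (gaussianVol n t) (gaussianVol n s) p T)
    (hS : IsIntegralOperator (fockKernel t) (gaussianVol n t) (gaussianVol n s) p S) :
    ‖S‖ ≤ ‖T‖ := by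
  have hac : gaussianVol n t ≪ gaussianVol n s :=
    (gaussianVol_absolutelyContinuous t).trans (volume_absolutelyContinuous_gaussianVol hs)
  refine S.opNorm_le_bound (norm_nonneg T) fun f => ?_
  have h := eLpNorm_kernelOp_le_of_norm (K := fockKernel t) hac (fun f _ => (hT f).2)
    (Lp.memLp f) (hS f).1
  rw [← eLpNorm_congr_ae (hS f).2] at h
  rw [Lp.norm_def, Lp.norm_def]
  have := ENNReal.toReal_mono (ENNReal.mul_ne_top ENNReal.ofReal_ne_top (Lp.memLp f).2.ne) h
  rwa [ENNReal.toReal_mul, ENNReal.toReal_ofReal (norm_nonneg T)] at this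

end FockKernel

theorem mainTheorem1 (n : ℕ) (hn : 1 ≤ n) (t s : ℝ) (ht : 0 < t) (hs : 0 < s)
    (p : ℝ≥0∞) [Fact (1 ≤ p)] (hp : p ≠ ∞) :
    List.TFAE
      [ IntegralOperatorBounded (absFockKernel t) (gaussianVol n t) (gaussianVol n s) p,
        IntegralOperatorBounded (fockKernel t) (gaussianVol n t) (gaussianVol n s) p,
        p.toReal * t = 2 * s,
        IntegralOperatorExtendsBounded (absFockKernel t) (gaussianVol n t) (gaussianVol n s) p,
        IntegralOperatorExtendsBounded (fockKernel t) (gaussianVol n t) (gaussianVol n s) p ] ∧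
    (p.toReal * t = 2 * s →
      ∃ T S : Lp ℂ p (gaussianVol n s) →L[ℂ] Lp ℂ p (gaussianVol n s),
        IsIntegralOperator (absFockKernel t) (gaussianVol n t) (gaussianVol n s) p T ∧
        IsIntegralOperator (fockKernel t) (gaussianVol n t) (gaussianVol n s) p S ∧
        ‖S‖ ≤ ‖T‖ ∧ ‖T‖ = 2 ^ n) := by
  have hp1 : 1 ≤ p := Fact.out
  have hp0 : p ≠ 0 := (zero_lt_one.trans_le hp1).ne'
  have hP : 1 ≤ p.toReal := by simpa using ENNReal.toReal_mono hp hp1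
  have hac : gaussianVol n t ≪ gaussianVol n s :=
    (gaussianVol_absolutelyContinuous t).trans (volume_absolutelyContinuous_gaussianVol hs)
  have hS : p.toReal * t = 2 * s → ∃ S : Lp ℂ p (gaussianVol n s) →L[ℂ] Lp ℂ p (gaussianVol n s),
      IsIntegralOperator (fockKernel t) (gaussianVol n t) (gaussianVol n s) p S ∧
        ‖S‖ ≤ 2 ^ n := fun hpt =>
    exists_isIntegralOperator hp hac (continuous_fockKernel t).stronglyMeasurable (by positivity)
      fun f hf => lintegral_fockKernel_rpow_le ht hs hP hpt hf.enorm
  have hT : p.toReal * t = 2 * s → ∃ T : Lp ℂ p (gaussianVol n s) →L[ℂ] Lp ℂ p (gaussianVol n s),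
      IsIntegralOperator (absFockKernel t) (gaussianVol n t) (gaussianVol n s) p T ∧
        ‖T‖ ≤ 2 ^ n := fun hpt =>
    exists_isIntegralOperator hp hac (continuous_absFockKernel t).stronglyMeasurable
      (by positivity) fun f hf => by
        simp_rw [enorm_absFockKernel]
        exact lintegral_fockKernel_rpow_le ht hs hP hpt hf.enorm
  constructor
  · tfae_have 3 → 1 := fun h => (hT h).imp fun _ h => h.1
    tfae_have 3 → 2 := fun h => (hS h).imp fun _ h => h.1
    tfae_have 1 → 4 := IntegralOperatorBounded.extends
    tfae_have 2 → 5 := IntegralOperatorBounded.extends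
    -- Domination transfers the bound for T_t to S_t, so one family of test functions serves both
    -- (a') and (b').
    tfae_have 4 → 3 := fun ⟨_, hB⟩ =>
      mul_eq_of_eLpNorm_kernelOp_fockKernel_le hn ht hs hp0 hp fun _ hf hc =>
        eLpNorm_kernelOp_le_of_norm hac hB hf hc
    tfae_have 5 → 3 := fun ⟨_, hB⟩ =>
      mul_eq_of_eLpNorm_kernelOp_fockKernel_le hn ht hs hp0 hp fun _ hf hc =>
        eLpNorm_kernelOp_le hac hB hf hc
    tfae_finish
  · intro hpt
    obtain ⟨T, hT1, hT2⟩ := hT hpt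
    obtain ⟨S, hS1, _⟩ := hS hpt
    exact ⟨T, S, hT1, hS1, norm_le_norm_of_isIntegralOperator hs hT1 hS1,
      le_antisymm hT2 (two_pow_le_norm_of_isIntegralOperator ht hs hp hpt hT1)⟩

end
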